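/- An oriented graph is a finite directed graph without loops, multiple arcs or pairs of opposite arcs. For an oriented graph $F$, let $\mathrm{ex}_o(n,F)$ be the largest number of arcs of an $n$-vertex oriented graph that does not contain $F$ as a (not necessarily induced) subgraph, with the convention that it is $0$ if every $n$-vertex oriented graph contains $F$. A homomorphism from $F$ to an oriented graph $T$ is a map $f\colon V(F)\to V(T)$ such that $f(u)f(v)$ is an arc of $T$ whenever $uv$ is an arc of $F$. The compressibility $z(F)$ is the smallest integer $k\ge 0$ such that $F$ has a homomorphism to every tournament on $k$ vertices; $z(F)=\infty$ if there is no such $k$. Proposition 2.5. Let $F_1$ and $F_2$ be oriented graphs with $z(F_1)<z(F_2)$, and let $F$ be the vertex-disjoint union of $F_1$ and $F_2$. Then there is an $N$, depending on $F_1$ and $F_2$, such that $\mathrm{ex}_o(n,F)=\mathrm{ex}_o(n,F_2)$ for all $n\ge N$. -/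

import Mathlib

/-- An oriented graph on `V`: a digraph without loops and without pairs of opposite arcs
(asymmetry of the arc relation rules out both). -/
structure OrientedGraph (V : Type*) extends Digraph V where
  asymm : ∀ u v : V, Adj u v → ¬ Adj v u

namespace OrientedGraph

/-- There is a homomorphism from `F` to `G`, i.e. a map of the vertices that sends arcs to arcs. -/
def HasHomTo {V W : Type*} (F : OrientedGraph V) (G : OrientedGraph W) : Prop :=
  Nonempty (F.Adj →r G.Adj)

/-- `G` contains `F` as a (not necessarily induced) subgraph. -/
def Contains {V W : Type*} (G : OrientedGraph W) (F : OrientedGraph V) : Prop :=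
  ∃ f : F.Adj →r G.Adj, Function.Injective f

/-- A tournament: any two distinct vertices are joined by an arc (by exactly one, as the graph is
oriented). -/
def IsTournament {V : Type*} (T : OrientedGraph V) : Prop :=
  ∀ u v : V, u ≠ v → T.Adj u v ∨ T.Adj v u

/-- The number of arcs. -/
noncomputable def numArcs {V : Type*} (G : OrientedGraph V) : ℕ :=
  {p : V × V | G.Adj p.1 p.2}.ncard

/-- The compressibility `z(F)`: the smallest `k` such that `F` has a homomorphism to every
tournament of order `k`, and `⊤` if there is no such `k`. -/
noncomputable def compressibility {V : Type*} (F : OrientedGraph V) : ℕ∞ :=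
  sInf {z : ℕ∞ | ∃ k : ℕ, z = k ∧ ∀ T : OrientedGraph (Fin k), T.IsTournament → F.HasHomTo T}

/-- The oriented Turán number `ex_o(n, F)`: the largest number of arcs of an `n`-vertex oriented
graph that does not contain `F` (the number of arcs is at most `n ^ 2`; the value is `0` if there
is no `F`-free oriented graph on `n` vertices). -/
noncomputable def exo {V : Type*} (n : ℕ) (F : OrientedGraph V) : ℕ :=
  sSup {m : ℕ | ∃ G : OrientedGraph (Fin n), ¬ G.Contains F ∧ G.numArcs = m}

/-- The vertex-disjoint union: the arcs are those of `F₁` and those of `F₂`. -/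
def disjUnion {V₁ V₂ : Type*} (F₁ : OrientedGraph V₁) (F₂ : OrientedGraph V₂) :
    OrientedGraph (V₁ ⊕ V₂) where
  Adj := Sum.LiftRel F₁.Adj F₂.Adj
  asymm := by
    rintro _ _ (⟨h⟩ | ⟨h⟩) (⟨h'⟩ | ⟨h'⟩)
    · exact F₁.asymm _ _ h (by assumption)
    · exact F₂.asymm _ _ h (by assumption)

end OrientedGraph

/-! Let `k` be the compressibility of `F₁`. Some tournament on `k` vertices admits no homomorphism
from `F₂`, and its balanced blow-up is `F₂`-free, so the optimum for `F₂` is at least the Turán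
number, about `(1 - 1/k) n²/2`. Now let `G` contain a copy of `F₂` but not the disjoint union. Away
from that copy, which meets only `O(n)` arcs, `G` has no `F₁`. A large complete `k`-partite piece
there would, by Ramsey cleaning, contain a blow-up of a tournament on `k` vertices and hence `F₁`.
Erdős-Stone thus leaves at most `(1 - 1/(k-1) + o(1)) n²/2` arcs, too few for large `n`
(`exists_numArcs_le`). The case `k ≤ 1`, where `F₁` has no arcs, is separate. -/

/-! ### Ramsey cleaning of multipartite graphs -/

open Finset in
/-- In any red-blue colouring of the edges of a large complete bipartite graph there is a large
monochromatic complete bipartite subgraph. -/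
theorem exists_monochromatic_bipartite (s : ℕ) :
    ∃ t : ℕ, ∀ {V : Type*} (c : V → V → Prop) (A B : Finset V), t ≤ #A → t ≤ #B →
      ∃ A' ⊆ A, ∃ B' ⊆ B, s ≤ #A' ∧ s ≤ #B' ∧
        ((∀ a ∈ A', ∀ b ∈ B', c a b) ∨ ∀ a ∈ A', ∀ b ∈ B', ¬ c a b) := by
  classical
  -- Fix `2 * s` vertices of `A`. By pigeonhole, `2 * s` vertices of `B` have the same neighbourhood
  -- `P` among them; `P` or its complement has size at least `s`.
  refine ⟨2 * s + 2 ^ (2 * s) * (2 * s), fun {V} c A B hA hB ↦ ?_⟩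
  obtain ⟨A₀, hA₀, hA₀s⟩ := exists_subset_card_eq ((Nat.le_add_right _ _).trans hA)
  obtain ⟨P, hP, hPs⟩ := exists_le_card_fiber_of_mul_le_card_of_maps_to
    (s := B) (t := A₀.powerset) (f := fun b ↦ {a ∈ A₀ | c a b}) (n := 2 * s)
    (fun b _ ↦ mem_powerset.2 (filter_subset _ _)) ⟨∅, empty_mem_powerset _⟩
    (by rw [card_powerset, hA₀s]; omega)
  set B' := ({x ∈ B | {a ∈ A₀ | c a x} = P} : Finset V) with hB'
  rw [mem_powerset] at hP
  have hmem {b : V} (hb : b ∈ B') {a : V}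
      (ha : a ∈ A₀) : a ∈ P ↔ c a b := by
    rw [← (mem_filter.1 hb).2]
    simp [ha]
  have hcard := card_sdiff_add_card_eq_card hP
  by_cases h : s ≤ #P
  · exact ⟨P, hP.trans hA₀, B', filter_subset _ _, h, by omega,
      .inl fun a ha b hb ↦ (hmem hb (hP ha)).1 ha⟩
  · refine ⟨A₀ \ P, sdiff_subset.trans hA₀, B', filter_subset _ _, by omega, by omega,
      .inr fun a ha b hb ↦ ?_⟩
    rw [mem_sdiff] at ha
    exact fun hc ↦ ha.2 ((hmem hb ha.1).2 hc)

open Finset in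
/-- A multipartite version of `exists_monochromatic_bipartite`, for prescribed pairs of parts. -/
theorem exists_monochromatic_multipartite {ι : Type*} (L : Finset (ι × ι))
    (hL : ∀ p ∈ L, p.1 ≠ p.2) (s : ℕ) :
    ∃ t : ℕ, ∀ {V : Type*} (c : V → V → Prop) (A : ι → Finset V), (∀ i, t ≤ #(A i)) →
      ∃ A' : ι → Finset V, (∀ i, A' i ⊆ A i) ∧ (∀ i, s ≤ #(A' i)) ∧
        ∀ p ∈ L, (∀ a ∈ A' p.1, ∀ b ∈ A' p.2, c a b) ∨ ∀ a ∈ A' p.1, ∀ b ∈ A' p.2, ¬ c a b := by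
  classical
  induction L using Finset.induction_on generalizing s with
  | empty => exact ⟨s, fun c A hA ↦ ⟨A, fun _ ↦ Subset.rfl, hA, by simp⟩⟩
  | insert p L hp ih =>
    obtain ⟨t₁, ht₁⟩ := exists_monochromatic_bipartite s
    obtain ⟨t₂, ht₂⟩ := ih (fun q hq ↦ hL q (mem_insert_of_mem hq)) (max s t₁)
    refine ⟨t₂, fun c A hA ↦ ?_⟩
    obtain ⟨A', hA', hA's, hc⟩ := ht₂ c A hA
    obtain ⟨B, hB, C, hC, hBs, hCs, hBC⟩ := ht₁ c (A' p.1) (A' p.2)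
      ((le_max_right _ _).trans (hA's _)) ((le_max_right _ _).trans (hA's _))
    have hne := hL p (mem_insert_self _ _)
    set A'' := Function.update (Function.update A' p.1 B) p.2 C with hA''
    have h₁ : A'' p.1 = B := by simp [hA'', hne]
    have h₂ : A'' p.2 = C := by simp [hA'']
    have h₃ (i : ι) : A'' i ⊆ A' i := by
      rcases eq_or_ne i p.2 with rfl | hi₂
      · rwa [h₂]
      rcases eq_or_ne i p.1 with rfl | hi₁
      · rwa [h₁]
      simp [hA'', hi₁, hi₂]
    refine ⟨A'', fun i ↦ (h₃ i).trans (hA' i), fun i ↦ ?_, fun q hq ↦ ?_⟩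
    · rcases eq_or_ne i p.2 with rfl | hi₂
      · rwa [h₂]
      rcases eq_or_ne i p.1 with rfl | hi₁
      · rwa [h₁]
      simpa [hA'', hi₁, hi₂] using (le_max_left _ _).trans (hA's i)
    · rcases mem_insert.1 hq with rfl | hq
      · rwa [h₁, h₂]
      · exact (hc q hq).imp (fun h a ha b hb ↦ h a (h₃ _ ha) b (h₃ _ hb))
          fun h a ha b hb ↦ h a (h₃ _ ha) b (h₃ _ hb)

/-! ### Edge counts for undirected graphs -/

namespace SimpleGraph

open Finset Filter

/-- An asymptotic upper bound on the extremal numbers of complete equipartite graphs: a weak form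
of the **Erdős-Stone theorem**. -/
theorem exists_extremalNumber_completeEquipartiteGraph_le {ε : ℝ} (hε : 0 < ε) {r t : ℕ}
    (hr : 0 < r) (ht : 0 < t) :
    ∃ C : ℝ, ∀ n : ℕ, (extremalNumber n (completeEquipartiteGraph (r + 1) t) : ℝ) ≤
      C + (1 - 1 / r + ε) * (n * (n + 1) / 2) := by
  classical
  set H := completeEquipartiteGraph (r + 1) t with hH
  obtain ⟨N, hN⟩ := eventually_atTop.1
    (eventually_completeEquipartiteGraph_isContained_of_minDegree hε r t)
  have hq : (0 : ℝ) ≤ 1 - 1 / r + ε := by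
    have : (1 : ℝ) / r ≤ 1 := by
      rw [div_le_one (by positivity)]
      exact_mod_cast hr
    linarith
  -- Delete a vertex of minimum degree from an extremal graph; summing over `n` turns the
  -- minimum-degree theorem into an edge bound.
  have hstep (n : ℕ) (hn : N ≤ n) : (extremalNumber (n + 1) H : ℝ) ≤
      extremalNumber n H + (1 - 1 / r + ε) * (n + 1) := by
    have hbot : H ≠ ⊥ := by
      rw [hH, Ne, completeEquipartiteGraph_eq_bot_iff]
      omega
    obtain ⟨G, _, hG⟩ := exists_isExtremal_free (V := Fin (n + 1)) hbot
    have hcard := card_edgeFinset_of_isExtremal_free hG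
    rw [Fintype.card_fin] at hcard
    obtain ⟨v, hv⟩ := G.exists_minimal_degree_vertex
    have hdel := card_edgeFinset_deleteIncidenceSet_le_extremalNumber hG.prop v
    rw [Fintype.card_fin, Nat.add_sub_cancel] at hdel
    have hsub := G.card_edgeFinset_deleteIncidenceSet v
    have hdeg : (G.minDegree : ℝ) < (1 - 1 / r + ε) * (n + 1 : ℕ) := by
      by_contra! h
      exact hG.prop (hN (n + 1) (by omega) h)
    have hle : extremalNumber (n + 1) H ≤ extremalNumber n H + G.minDegree := by
      rw [← hcard, hv]
      omega
    have hle' : (extremalNumber (n + 1) H : ℝ) ≤ extremalNumber n H + G.minDegree := by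
      exact_mod_cast hle
    push_cast at hdeg
    linarith
  refine ⟨∑ i ∈ range (N + 1), (extremalNumber i H : ℝ), fun n ↦ ?_⟩
  have hsmall (n : ℕ) (hn : n ≤ N) : (extremalNumber n H : ℝ) ≤
      ∑ i ∈ range (N + 1), (extremalNumber i H : ℝ) + (1 - 1 / r + ε) * (n * (n + 1) / 2) := by
    have := single_le_sum (f := fun i ↦ (extremalNumber i H : ℝ)) (fun i _ ↦ by positivity)
      (mem_range.2 (Nat.lt_succ_of_le hn))
    have : (0 : ℝ) ≤ (1 - 1 / r + ε) * (n * (n + 1) / 2) := by positivity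
    linarith
  induction n with
  | zero => exact hsmall 0 (Nat.zero_le _)
  | succ n ih =>
    rcases le_or_gt N n with hn | hn
    · have := hstep n hn
      push_cast
      linarith
    · exact hsmall _ hn

/-- A lower bound on the number of edges of the Turán graph. -/
theorem le_card_edgeFinset_turanGraph {n k : ℕ} (hk : 0 < k) :
    (1 - 1 / k : ℝ) * (n ^ 2 - k ^ 2) / 2 - 1 ≤ #(turanGraph n k).edgeFinset := by
  rw [card_edgeFinset_turanGraph]
  set m := n % k with hm
  have hmk : m < k := Nat.mod_lt _ hk
  have hmn : m ≤ n := Nat.mod_le _ _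
  -- Rounding in the division costs less than 1, whence the `- 1`.
  have h₁ : ((n ^ 2 - m ^ 2) * (k - 1) : ℕ) <
      2 * k * ((n ^ 2 - m ^ 2) * (k - 1) / (2 * k)) + 2 * k := by
    have := Nat.lt_mul_div_succ ((n ^ 2 - m ^ 2) * (k - 1)) (show 0 < 2 * k by omega)
    linarith
  have h₂ : (((n : ℝ) ^ 2 - m ^ 2) * (k - 1)) <
      2 * k * (((n ^ 2 - m ^ 2) * (k - 1) / (2 * k) : ℕ) : ℝ) + 2 * k := by
    have h := (Nat.cast_lt (α := ℝ)).2 h₁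
    rw [Nat.cast_mul, Nat.cast_sub (Nat.pow_le_pow_left hmn 2), Nat.cast_sub hk] at h
    push_cast at h ⊢
    exact h
  have hk₀ : (0 : ℝ) < k := by exact_mod_cast hk
  have hk₁ : (1 : ℝ) ≤ k := by exact_mod_cast hk
  have h₃ : ((n : ℝ) ^ 2 - k ^ 2) * (k - 1) ≤ ((n : ℝ) ^ 2 - m ^ 2) * (k - 1) := by
    have : (m : ℝ) ≤ k := by exact_mod_cast hmk.le
    gcongr
  have h₄ : (1 - 1 / k : ℝ) * (n ^ 2 - k ^ 2) / 2 - 1 =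
      (((n : ℝ) ^ 2 - k ^ 2) * (k - 1) - 2 * k) / (2 * k) := by
    field_simp
  rw [h₄, div_le_iff₀ (by positivity)]
  have h₅ : (0 : ℝ) ≤ (m.choose 2 : ℕ) * (2 * k) := by positivity
  push_cast at h₂ ⊢
  linarith

end SimpleGraph

/-! ### Oriented graphs and blow-ups of tournaments -/

namespace OrientedGraph

open Finset

section

variable {V : Type*} (G : OrientedGraph V)

/-- The underlying simple graph of an oriented graph. -/
def toSimpleGraph : SimpleGraph V where
  Adj u v := G.Adj u v ∨ G.Adj v u
  symm := ⟨fun _ _ h ↦ h.symm⟩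
  loopless := ⟨fun u h ↦ G.asymm u u (h.elim id id) (h.elim id id)⟩

theorem numArcs_eq_ncard_edgeSet : G.numArcs = G.toSimpleGraph.edgeSet.ncard := by
  have h : G.toSimpleGraph.edgeSet = (fun p : V × V ↦ s(p.1, p.2)) '' {p | G.Adj p.1 p.2} := by
    ext e
    induction e with | _ u v
    constructor
    · rintro (h | h)
      · exact ⟨(u, v), h, rfl⟩
      · exact ⟨(v, u), h, Sym2.eq_swap⟩
    · rintro ⟨⟨a, b⟩, hab, he⟩
      rw [← he]
      exact Or.inl hab
  rw [numArcs, h, Set.InjOn.ncard_image]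
  rintro ⟨a, b⟩ hab ⟨c, d⟩ hcd he
  rcases Sym2.eq_iff.1 he with ⟨h₁, h₂⟩ | ⟨h₁, h₂⟩
  · exact Prod.ext h₁ h₂
  · dsimp only at h₁ h₂
    subst h₁ h₂
    exact absurd hcd (G.asymm _ _ hab)

/-- If `F` has homomorphisms to all tournaments on `k` vertices, then any `k` large, pairwise
completely joined parts `A i` of an oriented graph contain a copy of `F`. -/
theorem exists_contains_of_forall_tournament {V₁ : Type*} [Finite V₁] (F : OrientedGraph V₁)
    {k : ℕ} (hF : ∀ T : OrientedGraph (Fin k), T.IsTournament → F.HasHomTo T) :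
    ∃ t : ℕ, ∀ {V : Type*} (G : OrientedGraph V) (A : Fin k → Finset V), (∀ i, t ≤ #(A i)) →
      (∀ i j, i ≠ j → ∀ a ∈ A i, ∀ b ∈ A j, G.toSimpleGraph.Adj a b) →
      ∃ f : F.Adj →r G.Adj, Function.Injective f ∧ ∀ v, ∃ i, f v ∈ A i := by
  classical
  have := Fintype.ofFinite V₁
  -- The `+ 1` keeps the parts nonempty when `V₁` is empty, as asymmetry of `T` needs.
  obtain ⟨t, ht⟩ := exists_monochromatic_multipartite
    {p : Fin k × Fin k | p.1 ≠ p.2} (by simp) (Fintype.card V₁ + 1)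
  refine ⟨t, fun {V} G A hA hadj ↦ ?_⟩
  obtain ⟨B, hBA, hBs, hB⟩ := ht G.Adj A hA
  have hne (i : Fin k) : (B i).Nonempty := card_pos.1 (by have := hBs i; omega)
  let T : OrientedGraph (Fin k) :=
    { Adj := fun i j ↦ ∀ a ∈ B i, ∀ b ∈ B j, G.Adj a b
      asymm := fun i j h h' ↦ by
        obtain ⟨a, ha⟩ := hne i
        obtain ⟨b, hb⟩ := hne j
        exact G.asymm _ _ (h a ha b hb) (h' b hb a ha) }
  have hT : T.IsTournament := fun i j hij ↦ (hB (i, j) (by simpa using hij)).imp id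
    fun h b hb a ha ↦
      (hadj i j hij a (hBA i ha) b (hBA j hb)).resolve_left (h a ha b hb)
  obtain ⟨g⟩ := hF T hT
  have (i : Fin k) : Nonempty (V₁ ↪ B i) := by
    rw [Function.Embedding.nonempty_iff_card_le, Fintype.card_coe]
    exact (Nat.le_succ _).trans (hBs i)
  let e (i : Fin k) : V₁ ↪ B i := (this i).some
  refine ⟨⟨fun v ↦ e (g v) v, fun {u v} huv ↦
    g.map_rel huv _ (e (g u) u).2 _ (e (g v) v).2⟩, fun u v huv ↦ ?_, fun v ↦
    ⟨g v, hBA _ (e (g v) v).2⟩⟩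
  change ((e (g u) u : B (g u)) : V) = (e (g v) v : B (g v)) at huv
  by_cases hg : g u = g v
  · rw [hg] at huv
    exact (e (g v)).injective (Subtype.ext huv)
  -- Distinct parts are disjoint: a common vertex would be adjacent to itself.
  · refine absurd (hadj _ _ hg _ (hBA _ (e (g u) u).2) _ (hBA _ (e (g v) v).2)) ?_
    rw [huv]
    exact G.toSimpleGraph.irrefl

theorem bddAbove_numArcs {W : Type*} (n : ℕ) (F : OrientedGraph W) :
    BddAbove {m : ℕ | ∃ G : OrientedGraph (Fin n), ¬ G.Contains F ∧ G.numArcs = m} := by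
  refine ⟨Nat.card (Fin n × Fin n), ?_⟩
  rintro _ ⟨G, -, rfl⟩
  exact Set.ncard_le_card _

theorem numArcs_le_exo {W : Type*} {n : ℕ} {F : OrientedGraph W} {G : OrientedGraph (Fin n)}
    (hG : ¬ G.Contains F) : G.numArcs ≤ exo n F :=
  le_csSup (bddAbove_numArcs n F) ⟨G, hG, rfl⟩

theorem contains_disjUnion {V₁ V₂ : Type*} {F₁ : OrientedGraph V₁} {F₂ : OrientedGraph V₂}
    {G : OrientedGraph V} {f : F₁.Adj →r G.Adj} {g : F₂.Adj →r G.Adj}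
    (hf : Function.Injective f) (hg : Function.Injective g) (hfg : ∀ u v, f u ≠ g v) :
    G.Contains (F₁.disjUnion F₂) := by
  refine ⟨⟨Sum.elim f g, ?_⟩, hf.sumElim hg hfg⟩
  rintro _ _ (h | h)
  · exact f.map_rel h
  · exact g.map_rel h

theorem Contains.of_disjUnion {V₁ V₂ : Type*} {F₁ : OrientedGraph V₁} {F₂ : OrientedGraph V₂}
    {G : OrientedGraph V} (h : G.Contains (F₁.disjUnion F₂)) : G.Contains F₂ := by
  obtain ⟨f, hf⟩ := h
  exact ⟨⟨fun v ↦ f (.inr v), fun h ↦ f.map_rel (Sum.LiftRel.inr h)⟩,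
    hf.comp Sum.inr_injective⟩

theorem exo_le_exo_disjUnion {V₁ V₂ : Type*} (n : ℕ) (F₁ : OrientedGraph V₁)
    (F₂ : OrientedGraph V₂) : exo n F₂ ≤ exo n (F₁.disjUnion F₂) := by
  refine csSup_le' ?_
  rintro _ ⟨G, hG, rfl⟩
  exact numArcs_le_exo fun h ↦ hG h.of_disjUnion

/-- Blowing up a tournament `T` on `k` vertices to which `F` has no homomorphism gives an `F`-free
orientation of the Turán graph. -/
theorem card_edgeFinset_turanGraph_le_exo {W : Type*} {F : OrientedGraph W} {k : ℕ} (hk : 0 < k)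
    {T : OrientedGraph (Fin k)} (hT : T.IsTournament) (hF : ¬ F.HasHomTo T) (n : ℕ) :
    #(SimpleGraph.turanGraph n k).edgeFinset ≤ exo n F := by
  let p (v : Fin n) : Fin k := ⟨v % k, Nat.mod_lt _ hk⟩
  let B : OrientedGraph (Fin n) :=
    { Adj := fun u v ↦ T.Adj (p u) (p v)
      asymm := fun u v ↦ T.asymm (p u) (p v) }
  have hB : B.toSimpleGraph = SimpleGraph.turanGraph n k := by
    ext u v
    rw [SimpleGraph.turanGraph_adj]
    constructor
    · intro h huv
      have hp : p u = p v := Fin.ext huv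
      have hloop : T.Adj (p v) (p v) := by
        have h' : T.Adj (p u) (p v) ∨ T.Adj (p v) (p u) := h
        rwa [hp, or_self] at h'
      exact T.asymm _ _ hloop hloop
    · intro h
      exact hT (p u) (p v) fun hp ↦ h (Fin.ext_iff.1 hp)
  have hfree : ¬ B.Contains F := fun ⟨f, _⟩ ↦ hF ⟨⟨fun v ↦ p (f v), fun h ↦ f.map_rel h⟩⟩
  have := numArcs_le_exo hfree
  rwa [numArcs_eq_ncard_edgeSet, hB, ← SimpleGraph.coe_edgeFinset, Set.ncard_coe_finset] at this

end

/-! ### Graphs containing `F₂` but not the disjoint union -/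

section

variable {V₁ V₂ : Type*} [Finite V₁] [Finite V₂] {F₁ : OrientedGraph V₁} {F₂ : OrientedGraph V₂}

/-- If `F₁` has no arcs, then a copy of `F₂` in a large graph extends to one of the disjoint
union. -/
theorem Contains.disjUnion_of_forall_not_adj {n : ℕ} (hF₁ : ∀ u v, ¬ F₁.Adj u v)
    (hn : Nat.card V₁ + Nat.card V₂ ≤ n) {G : OrientedGraph (Fin n)} (hG : G.Contains F₂) :
    G.Contains (F₁.disjUnion F₂) := by
  classical
  have := Fintype.ofFinite V₁
  have := Fintype.ofFinite V₂
  obtain ⟨g, hg⟩ := hG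
  have : Nonempty (V₁ ↪ ↥(univ.image g)ᶜ) := by
    rw [Function.Embedding.nonempty_iff_card_le, Fintype.card_coe, card_compl,
      card_image_of_injective _ hg, Fintype.card_fin, card_univ]
    simp only [Nat.card_eq_fintype_card] at hn
    omega
  obtain ⟨e⟩ := this
  refine contains_disjUnion (f := ⟨fun v ↦ e v, fun h ↦ absurd h (hF₁ _ _)⟩) (g := g)
    (Subtype.val_injective.comp e.injective) hg fun u v huv ↦ ?_
  have := (e u).2
  rw [mem_compl] at this
  exact this (mem_image.2 ⟨v, mem_univ _, huv.symm⟩)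

/-- An oriented graph that contains `F₂`, but not the disjoint union of `F₁` and `F₂`, has few
arcs if `F₁` has homomorphisms to all tournaments on `r + 1` vertices. -/
theorem exists_numArcs_le {r : ℕ} (hr : 0 < r)
    (hF₁ : ∀ T : OrientedGraph (Fin (r + 1)), T.IsTournament → F₁.HasHomTo T)
    {ε : ℝ} (hε : 0 < ε) :
    ∃ C : ℝ, ∀ (n : ℕ) (G : OrientedGraph (Fin n)), G.Contains F₂ →
      ¬ G.Contains (F₁.disjUnion F₂) →
      (G.numArcs : ℝ) ≤ C + (1 - 1 / r + ε) * (n * (n + 1) / 2) + Nat.card V₂ * n := by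
  classical
  have := Fintype.ofFinite V₂
  obtain ⟨t, ht⟩ := exists_contains_of_forall_tournament F₁ hF₁
  obtain ⟨C, hC⟩ := SimpleGraph.exists_extremalNumber_completeEquipartiteGraph_le hε hr
    (Nat.succ_pos t)
  refine ⟨C, fun n G ⟨g, hg⟩ hG ↦ ?_⟩
  let U := G.toSimpleGraph
  let S : Finset (Fin n) := univ.image g
  have hS : #S = Nat.card V₂ := by
    rw [card_image_of_injective _ hg, Nat.card_eq_fintype_card, card_univ]
  -- Isolating `S` instead of deleting it keeps the vertex type.
  let U' : SimpleGraph (Fin n) :=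
    { Adj := fun u v ↦ U.Adj u v ∧ u ∉ S ∧ v ∉ S
      symm := ⟨fun _ _ h ↦ ⟨h.1.symm, h.2.2, h.2.1⟩⟩
      loopless := ⟨fun _ h ↦ U.irrefl h.1⟩ }
  have hfree : (SimpleGraph.completeEquipartiteGraph (r + 1) (t + 1)).Free U' := by
    rintro ⟨φ⟩
    have hφ (i j : Fin (r + 1)) (hij : i ≠ j) (a b : Fin (t + 1)) :
        U'.Adj (φ (i, a)) (φ (j, b)) :=
      φ.toHom.map_adj (SimpleGraph.completeEquipartiteGraph_adj.2 hij)
    have hinj (i : Fin (r + 1)) : Function.Injective fun a : Fin (t + 1) ↦ φ (i, a) :=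
      fun a b h ↦ (Prod.ext_iff.1 (φ.injective h)).2
    obtain ⟨f, hf, hfA⟩ := ht G (fun i ↦ univ.image fun a ↦ φ (i, a))
      (fun i ↦ by simp [card_image_of_injective _ (hinj i)])
      (fun i j hij a ha b hb ↦ by
        obtain ⟨a, -, rfl⟩ := mem_image.1 ha
        obtain ⟨b, -, rfl⟩ := mem_image.1 hb
        exact (hφ i j hij a b).1)
    refine hG (contains_disjUnion hf hg fun u v huv ↦ ?_)
    obtain ⟨i, hi⟩ := hfA u
    obtain ⟨a, -, ha⟩ := mem_image.1 hi
    -- A second part gives each vertex of the copy a neighbour in `U'`, so it lies outside `S`.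
    have : Nontrivial (Fin (r + 1)) := Fin.nontrivial_iff_two_le.2 (by omega)
    obtain ⟨j, hj⟩ := exists_ne i
    refine (hφ i j hj.symm a a).2.1 ?_
    rw [ha, huv]
    exact mem_image_of_mem _ (mem_univ _)
  have hU' := SimpleGraph.card_edgeFinset_le_extremalNumber hfree
  rw [Fintype.card_fin] at hU'
  have hcover : U.edgeSet ⊆ ↑(U'.edgeFinset ∪ (S ×ˢ univ).image fun p ↦ s(p.1, p.2)) := by
    intro e he
    induction e with | _ u v
    rw [coe_union, SimpleGraph.coe_edgeFinset]
    by_cases hu : u ∈ S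
    · exact .inr (mem_image.2 ⟨(u, v), by simpa using hu, rfl⟩)
    by_cases hv : v ∈ S
    · exact .inr (mem_image.2 ⟨(v, u), by simpa using hv, Sym2.eq_swap⟩)
    · exact .inl ⟨he, hu, hv⟩
  have hle : G.numArcs ≤
      SimpleGraph.extremalNumber n (SimpleGraph.completeEquipartiteGraph (r + 1) (t + 1)) +
        Nat.card V₂ * n := by
    rw [numArcs_eq_ncard_edgeSet]
    refine (Set.ncard_le_ncard hcover (finite_toSet _)).trans ?_
    rw [Set.ncard_coe_finset]
    refine (card_union_le _ _).trans (add_le_add hU' (card_image_le.trans ?_))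
    rw [card_product, hS, card_univ, Fintype.card_fin]
  have hle' := (Nat.cast_le (α := ℝ)).2 hle
  push_cast at hle'
  linarith [hC n]

end

end OrientedGraph

open OrientedGraph Filter in
theorem proposition2p5 {V₁ V₂ : Type*} [Finite V₁] [Finite V₂]
    (F₁ : OrientedGraph V₁) (F₂ : OrientedGraph V₂)
    (hz : F₁.compressibility < F₂.compressibility) :
    ∃ N : ℕ, ∀ n : ℕ, N ≤ n →
      OrientedGraph.exo n (F₁.disjUnion F₂) = OrientedGraph.exo n F₂ := by
  suffices h : ∃ N : ℕ, ∀ n : ℕ, N ≤ n → ∀ G : OrientedGraph (Fin n), G.Contains F₂ →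
      ¬ G.Contains (F₁.disjUnion F₂) → G.numArcs ≤ exo n F₂ by
    obtain ⟨N, hN⟩ := h
    refine ⟨N, fun n hn ↦ le_antisymm (csSup_le' ?_) (exo_le_exo_disjUnion n F₁ F₂)⟩
    rintro _ ⟨G, hG, rfl⟩
    by_cases hG₂ : G.Contains F₂
    · exact hN n hn G hG₂ hG
    · exact numArcs_le_exo hG₂
  obtain ⟨_, ⟨k, rfl, hk₁⟩, hk⟩ := sInf_lt_iff.1 hz
  obtain ⟨T, hT, hF₂⟩ : ∃ T : OrientedGraph (Fin k), T.IsTournament ∧ ¬ F₂.HasHomTo T := by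
    by_contra! h
    exact hk.not_ge (sInf_le ⟨k, rfl, h⟩)
  rcases Nat.lt_or_ge k 2 with hk2 | hk2
  · have hF₁ (u v : V₁) : ¬ F₁.Adj u v := by
      intro huv
      obtain ⟨f⟩ := hk₁ T hT
      have : Subsingleton (Fin k) := Fin.subsingleton_iff_le_one.2 (by omega)
      have h := f.map_rel huv
      rw [Subsingleton.elim (f u) (f v)] at h
      exact T.asymm _ _ h h
    exact ⟨Nat.card V₁ + Nat.card V₂, fun n hn G hG₂ hG ↦
      absurd (hG₂.disjUnion_of_forall_not_adj hF₁ hn) hG⟩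
  obtain ⟨r, rfl⟩ : ∃ r, k = r + 1 := ⟨k - 1, by omega⟩
  have hr : 0 < r := by omega
  have hr' : (0 : ℝ) < r := by exact_mod_cast hr
  -- The gap between the two densities. Half is spent as `ε`; the other half leaves the surplus `δ /
  -- 4 * n ^ 2` that beats all lower-order terms.
  set δ : ℝ := 1 / r - 1 / (r + 1) with hδ
  have hδ₀ : 0 < δ := sub_pos.2 (one_div_lt_one_div_of_lt hr' (by linarith))
  obtain ⟨C, hC⟩ := exists_numArcs_le (F₂ := F₂) hr hk₁ (half_pos hδ₀)
  set q : ℝ := 1 - 1 / r + δ / 2 with hq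
  have hlim : Tendsto (fun n : ℕ ↦ (n : ℝ) * (δ / 4 * n - (q / 2 + Nat.card V₂))) atTop atTop :=
    tendsto_natCast_atTop_atTop.atTop_mul_atTop₀ (tendsto_atTop_add_const_right _ _
      (tendsto_natCast_atTop_atTop.const_mul_atTop (by positivity)))
  obtain ⟨N, hN⟩ := eventually_atTop.1
    (hlim.eventually_ge_atTop (C + (q + δ / 2) * (r + 1) ^ 2 / 2 + 1))
  refine ⟨N, fun n hn G hG₂ hG ↦ ?_⟩
  have h₁ := hC n G hG₂ hG
  have h₂ := SimpleGraph.le_card_edgeFinset_turanGraph (n := n) (k := r + 1) r.succ_pos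
  have h₃ := (Nat.cast_le (α := ℝ)).2
    (card_edgeFinset_turanGraph_le_exo r.succ_pos hT hF₂ n)
  have h₄ := hN n hn
  have h₅ : (1 - 1 / ((r + 1 : ℕ) : ℝ)) = q + δ / 2 := by
    rw [hq, hδ]
    push_cast
    ring
  rw [h₅] at h₂
  push_cast at h₂
  have h₆ : (G.numArcs : ℝ) ≤ exo n F₂ := by nlinarith
  exact_mod_cast h₆
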